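/- Let $G=\operatorname{Aff}_+(\mathbb R)=\{(x,y)\in\mathbb R^2 : y>0\}$ with product $(x_2,y_2)\cdot(x_1,y_1)=(x_2+y_2x_1,\,y_2y_1)$, identity $\mathrm{Id}=(0,1)$ and left-invariant frame $X_1=y\,\partial_x$, $X_2=y\,\partial_y$. Let $A=\begin{pmatrix}a&b\\c&d\end{pmatrix}$ be a real matrix with $\det A>0$, let $A^{-1}=\begin{pmatrix}\alpha&\beta\\\gamma&\delta\end{pmatrix}$, and equip $G$ with the left-invariant Lorentzian structure $$g(u_1X_1+u_2X_2)=-(au_1+bu_2)^2+(cu_1+du_2)^2,$$ time-oriented by $Y_1=\alpha X_1+\gamma X_2$ (so that a nonspacelike vector $u_1X_1+u_2X_2$ is future directed iff $au_1+bu_2>0$). A future directed nonspacelike curve is a Lipschitz curve $q:[0,t_1]\to G$, $t_1\ge 0$, whose velocity satisfies $g(\dot q)\le 0$ and is future directed for almost every $t$; its length is $\int_0^{t_1}|g(\dot q)|^{1/2}\,dt$. For $q_1\in G$ let $d(q_1)\in[0,+\infty]$ be the supremum of the lengths of the future directed nonspacelike curves from $\mathrm{Id}$ to $q_1$ ($d(q_1)=0$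 if there are none), and let $J^+$ be the set of points that such curves from $\mathrm{Id}$ reach. The structure $g$ has constant sectional curvature $K$. Assume that $K>0$. Put $$\Delta=\sqrt{\gamma^2-\delta^2},\quad \lambda=\frac{\alpha\delta-\beta\gamma}{\Delta^2},\quad \nu=\frac{\beta\delta-\alpha\gamma}{\Delta^2},\quad s_1=\operatorname{sgn}\gamma,$$ and, for $q_1=(x_1,y_1)\in G$, $w=\dfrac{x_1+\nu(y_1-1)}{\lambda}$; if $w\ne0$, put further $s_2=-s_1\operatorname{sgn}(\lambda w)$ and $$\tau=\operatorname{arcosh}\Big(s_2\,\frac{1-y_1^2-w^2}{2y_1w}\Big),\qquad \rho=\operatorname{arcosh}\Big(s_2\,\frac{1-y_1^2+w^2}{2w}\Big).$$ Then the following holds, with boundary and interior taken in $G$. 1. If $q_1\notin J^+$, then $d(q_1)=0$. 2. If $q_1\in\partial J^+$, then $d(q_1)=0$. 3. If $q_1\in\operatorname{int}J^+$ and $w\neq0$, then both arguments of $\operatorname{arcosh}$ above are greater than $1$ and $d(q_1)=s_1\,\dfrac{\rho-\tau}{\Delta}$. In particular $d(\operatorname{int}J^+\cap\{w\ne0\})=(0,+\infty)$.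 4. If $q_1\in\operatorname{int}J^+$ and $w=0$, then $d(q_1)=s_1\,\dfrac{\ln y_1}{\Delta}$. In particular $d(\operatorname{int}J^+\cap\{w=0\})=(0,+\infty)$. -/

import Mathlib

open Set MeasureTheory
open scoped ENNReal NNReal

noncomputable section

namespace AffLorentz

/-! ### The group of proper affine functions of the line -/

/-- `G = Aff₊(ℝ)`, the upper half-plane; `(x, y)` stands for the map `s ↦ y * s + x`. -/
def G : Set (ℝ × ℝ) := {q | 0 < q.2}

/-- The group product, given by composition of affine maps. -/
def mul (p q : ℝ × ℝ) : ℝ × ℝ := (p.1 + p.2 * q.1, p.2 * q.2)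

/-- The identity element of `G`. -/
def Id : ℝ × ℝ := (0, 1)

/-- The vector field `X₁ = y ∂/∂x`. -/
def X₁ (q : ℝ × ℝ) : ℝ × ℝ := (q.2, 0)

/-- The vector field `X₂ = y ∂/∂y`. -/
def X₂ (q : ℝ × ℝ) : ℝ × ℝ := (0, q.2)

/-- The frame `X₁, X₂` is left-invariant: left translations carry it to itself. -/
theorem frame_leftInvariant (p q : ℝ × ℝ) :
    fderiv ℝ (mul p) q (X₁ q) = X₁ (mul p q) ∧ fderiv ℝ (mul p) q (X₂ q) = X₂ (mul p q) := by
  have h1 : HasFDerivAt (fun q : ℝ × ℝ => p.1 + p.2 * q.1)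
      (p.2 • ContinuousLinearMap.fst ℝ ℝ ℝ) q :=
    ((hasFDerivAt_fst (𝕜 := ℝ) (p := q)).const_mul p.2).const_add p.1
  have h2 : HasFDerivAt (fun q : ℝ × ℝ => p.2 * q.2)
      (p.2 • ContinuousLinearMap.snd ℝ ℝ ℝ) q :=
    (hasFDerivAt_snd (𝕜 := ℝ) (p := q)).const_mul p.2
  have h := (h1.prodMk h2).fderiv
  have e : mul p = fun q : ℝ × ℝ => (p.1 + p.2 * q.1, p.2 * q.2) := rfl
  rw [e, h]
  simp [X₁, X₂]

/-! ### Left-invariant Lorentzian structures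

The structure attached to `A = !![a, b; c, d]` is `g = -(a u₁ + b u₂)² + (c u₁ + d u₂)²` on the
vector `u₁ X₁ + u₂ X₂`. -/

/-- The coordinate `v₁ = a u₁ + b u₂` of the tangent vector `v = u₁ X₁(q) + u₂ X₂(q)` at `q`. -/
def v₁ (A : Matrix (Fin 2) (Fin 2) ℝ) (q v : ℝ × ℝ) : ℝ :=
  A 0 0 * (v.1 / q.2) + A 0 1 * (v.2 / q.2)

/-- The coordinate `v₂ = c u₁ + d u₂` of the tangent vector `v = u₁ X₁(q) + u₂ X₂(q)` at `q`. -/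
def v₂ (A : Matrix (Fin 2) (Fin 2) ℝ) (q v : ℝ × ℝ) : ℝ :=
  A 1 0 * (v.1 / q.2) + A 1 1 * (v.2 / q.2)

/-- The Lorentzian structure at the point `q`, as a bilinear form in the tangent vectors. -/
def g (A : Matrix (Fin 2) (Fin 2) ℝ) (q v w : ℝ × ℝ) : ℝ :=
  -(v₁ A q v * v₁ A q w) + v₂ A q v * v₂ A q w

/-- The time orientation: the left-invariant timelike field `Y₁ = α X₁ + γ X₂`, where `(α, γ)` is
the first column of `A⁻¹`; it is the field with `v₁ = 1`, `v₂ = 0`. -/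
def Y₁ (A : Matrix (Fin 2) (Fin 2) ℝ) (q : ℝ × ℝ) : ℝ × ℝ :=
  A⁻¹ 0 0 • X₁ q + A⁻¹ 1 0 • X₂ q

/-- `q`, restricted to `[0, t₁]`, is a future directed nonspacelike Lipschitz curve in `G` from
`q₀` to `q₁`. -/
structure IsCausalCurve (A : Matrix (Fin 2) (Fin 2) ℝ) (q₀ q₁ : ℝ × ℝ) (t₁ : ℝ)
    (q : ℝ → ℝ × ℝ) : Prop where
  nonneg : 0 ≤ t₁
  mem : ∀ t ∈ Icc 0 t₁, q t ∈ G
  lipschitz : ∃ C : ℝ≥0, LipschitzOnWith C q (Icc 0 t₁)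
  start : q 0 = q₀
  finish : q t₁ = q₁
  nonspacelike : ∀ᵐ t ∂volume.restrict (Icc 0 t₁), g A (q t) (deriv q t) (deriv q t) ≤ 0
  future : ∀ᵐ t ∂volume.restrict (Icc 0 t₁), g A (q t) (deriv q t) (Y₁ A (q t)) < 0

/-- The Lorentzian length of a curve defined on `[0, t₁]`. -/
def length (A : Matrix (Fin 2) (Fin 2) ℝ) (t₁ : ℝ) (q : ℝ → ℝ × ℝ) : ℝ :=
  ∫ t in (0 : ℝ)..t₁, Real.sqrt |g A (q t) (deriv q t) (deriv q t)|

/-- The Lorentzian distance: the supremum of the lengths of the future directed nonspacelike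
curves from `q₀` to `q₁`, and `0` if there are none. -/
def dist (A : Matrix (Fin 2) (Fin 2) ℝ) (q₀ q₁ : ℝ × ℝ) : ℝ≥0∞ :=
  ⨆ (t₁ : ℝ) (q : ℝ → ℝ × ℝ) (_ : IsCausalCurve A q₀ q₁ t₁ q), ENNReal.ofReal (length A t₁ q)

/-- The causal future of `q₀`. -/
def causalFuture (A : Matrix (Fin 2) (Fin 2) ℝ) (q₀ : ℝ × ℝ) : Set (ℝ × ℝ) :=
  {q₁ | ∃ (t₁ : ℝ) (q : ℝ → ℝ × ℝ), IsCausalCurve A q₀ q₁ t₁ q}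

/-! ### Sectional curvature

Computed in the coordinates `(x, y)`, from the Levi-Civita connection. -/

/-- The coordinate vectors `∂/∂x`, `∂/∂y`. -/
def coordVec : Fin 2 → ℝ × ℝ := ![(1, 0), (0, 1)]

/-- The partial derivative in the `i`-th coordinate. -/
def partialDeriv (i : Fin 2) (f : ℝ × ℝ → ℝ) (q : ℝ × ℝ) : ℝ := fderiv ℝ f q (coordVec i)

/-- The Gram matrix of a metric `m` in the coordinates. -/
def gram (m : ℝ × ℝ → ℝ × ℝ → ℝ × ℝ → ℝ) (q : ℝ × ℝ) : Matrix (Fin 2) (Fin 2) ℝ :=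
  Matrix.of fun i j => m q (coordVec i) (coordVec j)

/-- The Christoffel symbol `Γᵏᵢⱼ`, the `k`-th coordinate of `D_{∂ᵢ} ∂ⱼ`. -/
def christoffel (m : ℝ × ℝ → ℝ × ℝ → ℝ × ℝ → ℝ) (k i j : Fin 2) (q : ℝ × ℝ) : ℝ :=
  (1 / 2) * ∑ l, (gram m q)⁻¹ k l *
    (partialDeriv i (fun p => gram m p j l) q + partialDeriv j (fun p => gram m p i l) q
      - partialDeriv l (fun p => gram m p i j) q)

/-- The `l`-th coordinate of `R_{∂ᵢ ∂ⱼ} ∂ₖ`, with `R_{XY} Z = D_{[X,Y]} Z - [D_X, D_Y] Z`. -/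
def riemann (m : ℝ × ℝ → ℝ × ℝ → ℝ × ℝ → ℝ) (l i j k : Fin 2) (q : ℝ × ℝ) : ℝ :=
  partialDeriv j (christoffel m l i k) q - partialDeriv i (christoffel m l j k) q
    + ∑ r, (christoffel m r i k q * christoffel m l j r q
      - christoffel m r j k q * christoffel m l i r q)

/-- The sectional curvature at `q`: `g(R_{vw} v, w) / (g(v, v) g(w, w) - g(v, w)²)` for
`v = ∂/∂x`, `w = ∂/∂y`. -/
def sectionalCurvature (m : ℝ × ℝ → ℝ × ℝ → ℝ × ℝ → ℝ) (q : ℝ × ℝ) : ℝ :=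
  (∑ l, riemann m l 0 1 0 q * gram m q l 1) /
    (gram m q 0 0 * gram m q 1 1 - (gram m q 0 1) ^ 2)

/-- The curvature of the left-invariant structure attached to `A`, taken at the identity: left
translations are isometries, so that it is the same at all points. -/
def K (A : Matrix (Fin 2) (Fin 2) ℝ) : ℝ := sectionalCurvature (g A) Id

/-! ### The explicit formulas

Here `A⁻¹ = !![α, β; γ, δ]`. -/

/-- `Δ = √(γ² - δ²)`. -/
def Δ (A : Matrix (Fin 2) (Fin 2) ℝ) : ℝ := Real.sqrt ((A⁻¹ 1 0) ^ 2 - (A⁻¹ 1 1) ^ 2)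

/-- `λ = (αδ - βγ) / Δ²`. -/
def lam (A : Matrix (Fin 2) (Fin 2) ℝ) : ℝ :=
  (A⁻¹ 0 0 * A⁻¹ 1 1 - A⁻¹ 0 1 * A⁻¹ 1 0) / Δ A ^ 2

/-- `ν = (βδ - αγ) / Δ²`. -/
def nu (A : Matrix (Fin 2) (Fin 2) ℝ) : ℝ :=
  (A⁻¹ 0 1 * A⁻¹ 1 1 - A⁻¹ 0 0 * A⁻¹ 1 0) / Δ A ^ 2

/-- `s₁ = sgn γ`. -/
def s₁ (A : Matrix (Fin 2) (Fin 2) ℝ) : ℝ := Real.sign (A⁻¹ 1 0)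

/-- `w = (x + ν (y - 1)) / λ`. -/
def w (A : Matrix (Fin 2) (Fin 2) ℝ) (q : ℝ × ℝ) : ℝ := (q.1 + nu A * (q.2 - 1)) / lam A

/-- `s₂ = -s₁ sgn(λ w)`. -/
def s₂ (A : Matrix (Fin 2) (Fin 2) ℝ) (q : ℝ × ℝ) : ℝ := -(s₁ A * Real.sign (lam A * w A q))

/-- The argument of `arcosh` in `τ`. -/
def coshTau (A : Matrix (Fin 2) (Fin 2) ℝ) (q : ℝ × ℝ) : ℝ :=
  s₂ A q * ((1 - q.2 ^ 2 - w A q ^ 2) / (2 * q.2 * w A q))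

/-- The argument of `arcosh` in `ρ`. -/
def coshRho (A : Matrix (Fin 2) (Fin 2) ℝ) (q : ℝ × ℝ) : ℝ :=
  s₂ A q * ((1 - q.2 ^ 2 + w A q ^ 2) / (2 * w A q))

def τ (A : Matrix (Fin 2) (Fin 2) ℝ) (q : ℝ × ℝ) : ℝ := Real.arcosh (coshTau A q)

def ρ (A : Matrix (Fin 2) (Fin 2) ℝ) (q : ℝ × ℝ) : ℝ := Real.arcosh (coshRho A q)

end AffLorentz

end

namespace AffLorentz

/-! ### The curvature in terms of `A` -/

/-! The Levi-Civita computation gives `K = γ² - δ²` (`K_eq`), so `K > 0` means `|δ| < |γ|` and `Δ² =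
K`. The coordinates `(w, y)` are chosen so that the metric becomes `(dw² - dy²) / (Δ y)²`
(`g_self_eq`): it is conformal to the Minkowski plane, and `s₁ y` increases towards the future
(`causal_iff`). Hence the future of the identity is the part of the cone `|w| ≤ s₁ (y - 1)` that
lies in `y > 0`. A causal curve that ends on the boundary of the cone keeps a null coordinate
constant, so it is null almost everywhere and has length zero.

In the interior, the upper bound is a calibration. For each `p` the function `F = p w + s₁ f_p(y)`,
with `f_p = eikonal p`, solves `F_y² - F_w² = y⁻²`, and the reversed Cauchy–Schwarz inequality gives
`Δ * length ≤ F(q₁) - F(Id)` for every causal curve (`IsCausalCurve.length_le`). The bound is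
attained on arcs of the hyperbolas `(w + ε cosh ρ)² - y² = sinh² ρ` with `ε = ±1`, parametrized by
`y = sinh ρ / sinh θ` where `θ` runs from `ρ` to `τ`. Their Lorentzian speed in `θ` is `1 / Δ`, so
their length is `s₁ (ρ - τ) / Δ` (`dist_geodesic`). Solving for the endpoint yields the stated `ρ`
and `τ`. The case `w = 0` is `p = 0`, with vertical lines as maximizers. Neither the geodesic
equation nor an existence theorem for maximizers enters. -/

theorem partialDeriv_zero_comp_snd (f : ℝ → ℝ) (q : ℝ × ℝ) (hf : DifferentiableAt ℝ f q.2) :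
    partialDeriv 0 (fun p => f p.2) q = 0 := by
  have h := (hf.hasDerivAt.hasFDerivAt.comp q (hasFDerivAt_snd (𝕜 := ℝ) (p := q))).fderiv
  simp only [Function.comp_def] at h
  simp [partialDeriv, coordVec, h]

theorem partialDeriv_one_comp_snd (f : ℝ → ℝ) (q : ℝ × ℝ) (f' : ℝ) (hf : HasDerivAt f f' q.2) :
    partialDeriv 1 (fun p => f p.2) q = f' := by
  have h := (hf.hasFDerivAt.comp q (hasFDerivAt_snd (𝕜 := ℝ) (p := q))).fderiv
  simp only [Function.comp_def] at h
  simp [partialDeriv, coordVec, h]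

/-- The Gram matrix of the structure attached to `A` at the identity. -/
noncomputable def gramId (A : Matrix (Fin 2) (Fin 2) ℝ) : Matrix (Fin 2) (Fin 2) ℝ :=
  Matrix.of fun i j => -(A 0 i * A 0 j) + A 1 i * A 1 j

/-- The frame is `y` times the coordinate frame, so every curvature ingredient is a constant times a
power of `y`. -/
theorem gram_g (A : Matrix (Fin 2) (Fin 2) ℝ) (p : ℝ × ℝ) :
    gram (g A) p = (p.2 ^ 2)⁻¹ • gramId A := by
  ext i j
  fin_cases i <;> fin_cases j <;>
    simp [gram, gramId, g, v₁, v₂, coordVec] <;> ring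

theorem det_gramId (A : Matrix (Fin 2) (Fin 2) ℝ) : (gramId A).det = -A.det ^ 2 := by
  simp [gramId, Matrix.det_fin_two]; ring

theorem gram_g_inv (A : Matrix (Fin 2) (Fin 2) ℝ) (hA : A.det ≠ 0) (p : ℝ × ℝ) (hp : p.2 ≠ 0) :
    (gram (g A) p)⁻¹ = p.2 ^ 2 • (gramId A)⁻¹ := by
  rw [gram_g]
  apply Matrix.inv_eq_left_inv
  rw [Matrix.smul_mul, Matrix.mul_smul, smul_smul,
    Matrix.nonsing_inv_mul _ (by rw [det_gramId]; simpa using hA)]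
  rw [mul_inv_cancel₀ (by positivity), one_smul]

theorem partialDeriv_gram (A : Matrix (Fin 2) (Fin 2) ℝ) (k i j : Fin 2) (p : ℝ × ℝ)
    (hp : p.2 ≠ 0) :
    partialDeriv k (fun p => gram (g A) p i j) p =
      if k = 0 then 0 else -2 * gramId A i j * (p.2 ^ 3)⁻¹ := by
  have e : (fun p : ℝ × ℝ => gram (g A) p i j) =
      fun p : ℝ × ℝ => (fun y : ℝ => (y ^ 2)⁻¹ * gramId A i j) p.2 := by
    funext p; simp [gram_g]
  have h : HasDerivAt (fun y : ℝ => (y ^ 2)⁻¹ * gramId A i j)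
      (-2 * gramId A i j * (p.2 ^ 3)⁻¹) p.2 := by
    refine (((hasDerivAt_pow 2 p.2).fun_inv (pow_ne_zero 2 hp)).mul_const
      (gramId A i j)).congr_deriv ?_
    field_simp
    push_cast
    ring
  rw [e]
  fin_cases k
  · simpa using partialDeriv_zero_comp_snd _ p h.differentiableAt
  · simpa using partialDeriv_one_comp_snd _ p _ h

/-- The Christoffel symbols at the identity. -/
noncomputable def christoffelId (A : Matrix (Fin 2) (Fin 2) ℝ) (k i j : Fin 2) : ℝ :=
  -∑ l, (gramId A)⁻¹ k l * ((if i = 0 then 0 else gramId A j l) +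
    (if j = 0 then 0 else gramId A i l) - (if l = 0 then 0 else gramId A i j))

theorem christoffel_g (A : Matrix (Fin 2) (Fin 2) ℝ) (hA : A.det ≠ 0) (k i j : Fin 2) (p : ℝ × ℝ)
    (hp : p.2 ≠ 0) : christoffel (g A) k i j p = christoffelId A k i j * p.2⁻¹ := by
  simp only [christoffel, christoffelId, gram_g_inv A hA p hp, partialDeriv_gram A _ _ _ p hp,
    Fin.sum_univ_two, Matrix.smul_apply, smul_eq_mul]
  fin_cases i <;> fin_cases j <;> simp <;> field_simp <;> ring

theorem partialDeriv_christoffel (A : Matrix (Fin 2) (Fin 2) ℝ) (hA : A.det ≠ 0)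
    (r k i j : Fin 2) :
    partialDeriv r (christoffel (g A) k i j) Id = if r = 0 then 0 else -christoffelId A k i j := by
  -- The closed form needs `y ≠ 0`, so it is available only near the identity; this is enough for a
  -- derivative.
  have e : christoffel (g A) k i j =ᶠ[nhds Id]
      fun p : ℝ × ℝ => (fun y : ℝ => christoffelId A k i j * y⁻¹) p.2 := by
    have : ∀ᶠ p : ℝ × ℝ in nhds Id, p.2 ≠ 0 :=
      continuous_snd.continuousAt.eventually_ne (by simp [Id])
    filter_upwards [this] with p hp using christoffel_g A hA k i j p hp
  have h : HasDerivAt (fun y : ℝ => christoffelId A k i j * y⁻¹) (-christoffelId A k i j)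
      Id.2 := by
    refine ((hasDerivAt_inv (x := (Id.2 : ℝ)) (by simp [Id])).const_mul
      (christoffelId A k i j)).congr_deriv ?_
    simp [Id]
  have e' : partialDeriv r (christoffel (g A) k i j) Id =
      partialDeriv r (fun p : ℝ × ℝ => (fun y : ℝ => christoffelId A k i j * y⁻¹) p.2) Id := by
    simp only [partialDeriv, e.fderiv_eq]
  rw [e']
  fin_cases r
  · simpa using partialDeriv_zero_comp_snd _ Id h.differentiableAt
  · simpa using partialDeriv_one_comp_snd _ Id _ h

theorem K_eq (A : Matrix (Fin 2) (Fin 2) ℝ) (hA : A.det ≠ 0) :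
    K A = (A⁻¹ 1 0) ^ 2 - (A⁻¹ 1 1) ^ 2 := by
  have hgram : gram (g A) Id = gramId A := by simp [gram_g, Id]
  have hchr : ∀ k i j, christoffel (g A) k i j Id = christoffelId A k i j := fun k i j => by
    rw [christoffel_g A hA k i j Id (by simp [Id])]; simp [Id]
  have hQ : gramId A 0 0 * gramId A 1 1 - (gramId A 0 1) ^ 2 = -A.det ^ 2 := by
    rw [← det_gramId, Matrix.det_fin_two]
    simp [gramId]; ring
  have hi : ∀ i j, (gramId A)⁻¹ i j = -(A.det ^ 2)⁻¹ * (gramId A).adjugate i j := fun i j => by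
    rw [Matrix.inv_def, det_gramId]; simp [Ring.inverse_eq_inv', inv_neg]
  simp only [K, sectionalCurvature, riemann, hgram, hchr, partialDeriv_christoffel A hA, hQ]
  simp only [Fin.sum_univ_two, christoffelId, hi, Matrix.adjugate_fin_two]
  have hd : A.det = A 0 0 * A 1 1 - A 0 1 * A 1 0 := Matrix.det_fin_two A
  rw [Matrix.inv_def A, Matrix.adjugate_fin_two]
  simp [gramId, Ring.inverse_eq_inv']
  field_simp
  rw [hd]
  ring

end AffLorentz

namespace AffLorentz

/-! ### The structure in the coordinates `(w, y)` -/

section Vectors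

variable {A : Matrix (Fin 2) (Fin 2) ℝ}

/-- The differential of `w`. -/
noncomputable def dw (A : Matrix (Fin 2) (Fin 2) ℝ) (v : ℝ × ℝ) : ℝ := (v.1 + nu A * v.2) / lam A

theorem Δ_pos (hA : 0 < A.det) (hK : 0 < K A) : 0 < Δ A :=
  Real.sqrt_pos.2 (by rwa [← K_eq A hA.ne'])

theorem Δ_sq (hA : 0 < A.det) (hK : 0 < K A) : Δ A ^ 2 = (A⁻¹ 1 0) ^ 2 - (A⁻¹ 1 1) ^ 2 :=
  Real.sq_sqrt (by rw [← K_eq A hA.ne']; exact hK.le)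

theorem inv_zero_zero : A⁻¹ 0 0 = A.det⁻¹ * A 1 1 := by
  rw [Matrix.inv_def, Matrix.adjugate_fin_two]; simp [Ring.inverse_eq_inv']

theorem inv_zero_one : A⁻¹ 0 1 = -(A.det⁻¹ * A 0 1) := by
  rw [Matrix.inv_def, Matrix.adjugate_fin_two]; simp [Ring.inverse_eq_inv']

theorem inv_one_zero : A⁻¹ 1 0 = -(A.det⁻¹ * A 1 0) := by
  rw [Matrix.inv_def, Matrix.adjugate_fin_two]; simp [Ring.inverse_eq_inv']

theorem inv_one_one : A⁻¹ 1 1 = A.det⁻¹ * A 0 0 := by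
  rw [Matrix.inv_def, Matrix.adjugate_fin_two]; simp [Ring.inverse_eq_inv']

theorem det_inv_entries (hA : 0 < A.det) :
    0 < A⁻¹ 0 0 * A⁻¹ 1 1 - A⁻¹ 0 1 * A⁻¹ 1 0 := by
  have h : A⁻¹ 0 0 * A⁻¹ 1 1 - A⁻¹ 0 1 * A⁻¹ 1 0 = A.det⁻¹ := by
    have hd : A 0 0 * A 1 1 - A 0 1 * A 1 0 = A.det := (Matrix.det_fin_two A).symm
    rw [inv_zero_zero, inv_zero_one, inv_one_zero, inv_one_one]
    have : A.det ≠ 0 := hA.ne'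
    field_simp
    linarith
  rw [h]
  positivity

theorem lam_pos (hA : 0 < A.det) (hK : 0 < K A) : 0 < lam A :=
  div_pos (det_inv_entries hA) (pow_pos (Δ_pos hA hK) 2)

theorem inv_one_zero_ne (hA : 0 < A.det) (hK : 0 < K A) : A⁻¹ 1 0 ≠ 0 := by
  intro h
  have h1 := K_eq A hA.ne'
  rw [h] at h1
  nlinarith [sq_nonneg (A⁻¹ 1 1)]

theorem s₁_cases (hA : 0 < A.det) (hK : 0 < K A) : s₁ A = 1 ∨ s₁ A = -1 := by
  rcases Real.sign_apply_eq_of_ne_zero _ (inv_one_zero_ne hA hK) with h | h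
  · exact Or.inr h
  · exact Or.inl h

theorem s₁_sq (hA : 0 < A.det) (hK : 0 < K A) : s₁ A * s₁ A = 1 := by
  rcases s₁_cases hA hK with h | h <;> rw [h] <;> norm_num

/-- This is where `K > 0` acts on the causal structure: `dy / y = γ v₁ + δ v₂` then has the sign
`s₁` on the whole future cone. -/
theorem s₁_mul_inv (hA : 0 < A.det) (hK : 0 < K A) : |A⁻¹ 1 1| < s₁ A * A⁻¹ 1 0 := by
  have h : s₁ A * A⁻¹ 1 0 = |A⁻¹ 1 0| := by
    rcases lt_or_gt_of_ne (inv_one_zero_ne hA hK) with h | h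
    · rw [s₁, Real.sign_of_neg h, abs_of_neg h]; ring
    · rw [s₁, Real.sign_of_pos h, abs_of_pos h]; ring
  rw [h, ← sq_lt_sq]
  linarith [K_eq A hA.ne']

theorem snd_eq (hA : 0 < A.det) {q : ℝ × ℝ} (hq : 0 < q.2) (v : ℝ × ℝ) :
    v.2 = q.2 * (A⁻¹ 1 0 * v₁ A q v + A⁻¹ 1 1 * v₂ A q v) := by
  rw [inv_one_zero, inv_one_one, v₁, v₂]
  have hd : A 0 0 * A 1 1 - A 0 1 * A 1 0 = A.det := (Matrix.det_fin_two A).symm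
  have : A.det ≠ 0 := hA.ne'
  field_simp
  rw [← hd]
  ring

theorem fst_eq (hA : 0 < A.det) {q : ℝ × ℝ} (hq : 0 < q.2) (v : ℝ × ℝ) :
    v.1 = q.2 * (A⁻¹ 0 0 * v₁ A q v + A⁻¹ 0 1 * v₂ A q v) := by
  rw [inv_zero_zero, inv_zero_one, v₁, v₂]
  have hd : A 0 0 * A 1 1 - A 0 1 * A 1 0 = A.det := (Matrix.det_fin_two A).symm
  have : A.det ≠ 0 := hA.ne'
  field_simp
  rw [← hd]
  ring

/-- Together with `snd_eq` this explains `λ` and `ν`: `(dy, -dw) / y` arises from `(v₁, v₂)` by the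
matrix with rows `(γ, δ)` and `(δ, γ)`, which multiplies the form `v₁² - v₂²` by `Δ²`. -/
theorem dw_eq (hA : 0 < A.det) (hK : 0 < K A) {q : ℝ × ℝ} (hq : 0 < q.2) (v : ℝ × ℝ) :
    dw A v = -(q.2 * (A⁻¹ 1 1 * v₁ A q v + A⁻¹ 1 0 * v₂ A q v)) := by
  have hl := lam_pos hA hK
  have hD := Δ_pos hA hK
  rw [dw, div_eq_iff hl.ne', fst_eq hA hq v, snd_eq hA hq v, lam, nu]
  generalize v₁ A q v = a
  generalize v₂ A q v = b
  have h2 := Δ_sq hA hK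
  field_simp
  rw [h2]
  ring

theorem g_self (A : Matrix (Fin 2) (Fin 2) ℝ) (q v : ℝ × ℝ) :
    g A q v v = -(v₁ A q v ^ 2 - v₂ A q v ^ 2) := by
  rw [g]; ring

theorem g_self_eq (hA : 0 < A.det) (hK : 0 < K A) {q : ℝ × ℝ} (hq : 0 < q.2) (v : ℝ × ℝ) :
    g A q v v = -((v.2 ^ 2 - dw A v ^ 2) / (q.2 * Δ A) ^ 2) := by
  have hD := Δ_pos hA hK
  have h2 := Δ_sq hA hK
  rw [g_self, dw_eq hA hK hq, eq_neg_iff_add_eq_zero, neg_add_eq_zero, eq_div_iff (by positivity),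
    mul_pow, h2]
  have h := snd_eq hA hq v
  generalize v₁ A q v = a at *
  generalize v₂ A q v = b at *
  rw [h]
  ring

theorem g_Y₁ (hA : 0 < A.det) {q : ℝ × ℝ} (hq : 0 < q.2) (v : ℝ × ℝ) :
    g A q v (Y₁ A q) = -v₁ A q v := by
  have hd : A 0 0 * A 1 1 - A 0 1 * A 1 0 = A.det := (Matrix.det_fin_two A).symm
  have h0 : A.det ≠ 0 := hA.ne'
  have h1 : v₁ A q (Y₁ A q) = 1 := by
    simp only [v₁, Y₁, X₁, X₂, inv_zero_zero, inv_one_zero, Prod.smul_mk, smul_eq_mul, Prod.mk_add_mk]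
    field_simp
    rw [← hd]
    ring
  have h2 : v₂ A q (Y₁ A q) = 0 := by
    simp only [v₂, Y₁, X₁, X₂, inv_zero_zero, inv_one_zero, Prod.smul_mk, smul_eq_mul, Prod.mk_add_mk]
    field_simp
    ring
  rw [g, h1, h2]; ring

/-- Future directed nonspacelike vectors in the coordinates `(w, y)`. -/
theorem causal_iff (hA : 0 < A.det) (hK : 0 < K A) {q : ℝ × ℝ} (hq : 0 < q.2) (v : ℝ × ℝ) :
    (g A q v v ≤ 0 ∧ g A q v (Y₁ A q) < 0) ↔ (0 < s₁ A * v.2 ∧ |dw A v| ≤ s₁ A * v.2) := by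
  have hD := Δ_pos hA hK
  have e1 : g A q v v ≤ 0 ↔ |dw A v| ≤ |s₁ A * v.2| := by
    have hs : (s₁ A * v.2) ^ 2 = v.2 ^ 2 := by
      rw [mul_pow, pow_two (s₁ A), s₁_sq hA hK, one_mul]
    rw [g_self_eq hA hK hq, ← sq_le_sq, hs, neg_nonpos, div_nonneg_iff]
    have : 0 < (q.2 * Δ A) ^ 2 := by positivity
    constructor
    · rintro (h | h)
      · linarith
      · linarith [h.2]
    · intro h
      exact Or.inl ⟨by linarith, this.le⟩
  have e2 : s₁ A * v.2 = q.2 * (s₁ A * A⁻¹ 1 0 * v₁ A q v + s₁ A * A⁻¹ 1 1 * v₂ A q v) := by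
    rw [snd_eq hA hq v]; ring
  have hd : |s₁ A * A⁻¹ 1 1| < s₁ A * A⁻¹ 1 0 := by
    rw [abs_mul]
    have : |s₁ A| = 1 := by rcases s₁_cases hA hK with h | h <;> rw [h] <;> norm_num
    rw [this, one_mul]
    exact s₁_mul_inv hA hK
  have e3 : g A q v v ≤ 0 ↔ |v₂ A q v| ≤ |v₁ A q v| := by
    rw [g_self, ← sq_le_sq]; constructor <;> intro h <;> linarith
  have key : ∀ c e a b : ℝ, |e| < c → |b| ≤ a → 0 < a → 0 < c * a + e * b := by
    intro c e a b h1 h2 h3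
    have : |e * b| ≤ |e| * a := by
      rw [abs_mul]; exact mul_le_mul_of_nonneg_left h2 (abs_nonneg _)
    nlinarith [neg_abs_le (e * b)]
  rw [g_Y₁ hA hq, neg_lt_zero]
  constructor
  · rintro ⟨h1, h2⟩
    have h3 := e3.1 h1
    rw [abs_of_pos h2] at h3
    have h4 : 0 < s₁ A * v.2 := by
      rw [e2]; exact mul_pos hq (key _ _ _ _ hd h3 h2)
    refine ⟨h4, ?_⟩
    have := e1.1 h1
    rwa [abs_of_pos h4] at this
  · rintro ⟨h1, h2⟩
    have hg : g A q v v ≤ 0 := e1.2 (h2.trans (le_abs_self _))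
    refine ⟨hg, ?_⟩
    have h3 := e3.1 hg
    -- The past cone is excluded by applying `key` to the opposite vector.
    rcases lt_trichotomy (v₁ A q v) 0 with h | h | h
    · exfalso
      rw [abs_of_neg h] at h3
      have := key _ _ (-v₁ A q v) (-v₂ A q v) hd (by rwa [abs_neg]) (by linarith)
      rw [e2] at h1
      have := mul_pos hq this
      linarith
    · exfalso
      rw [h, abs_zero, abs_nonpos_iff] at h3
      rw [e2, h, h3] at h1
      simp at h1
    · exact h

theorem sqrt_abs_g (hA : 0 < A.det) (hK : 0 < K A) {q : ℝ × ℝ} (hq : 0 < q.2) {v : ℝ × ℝ}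
    (hv : |dw A v| ≤ s₁ A * v.2) :
    Real.sqrt |g A q v v| = Real.sqrt (v.2 ^ 2 - dw A v ^ 2) / (q.2 * Δ A) := by
  have hD := Δ_pos hA hK
  have hs : (s₁ A * v.2) ^ 2 = v.2 ^ 2 := by
    rw [mul_pow, pow_two (s₁ A), s₁_sq hA hK, one_mul]
  have h0 : 0 ≤ v.2 ^ 2 - dw A v ^ 2 := by
    have := sq_le_sq' (by linarith [abs_nonneg (dw A v)]) hv
    rw [sq_abs, hs] at this
    linarith
  rw [g_self_eq hA hK hq, abs_neg, abs_of_nonneg (by positivity), Real.sqrt_div h0,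
    Real.sqrt_sq (by positivity)]

end Vectors

end AffLorentz

namespace AffLorentz

/-! ### Causal curves and calibrations -/

section Curves

variable {A : Matrix (Fin 2) (Fin 2) ℝ} {T : ℝ} {q : ℝ → ℝ × ℝ} {q₀ q₁ : ℝ × ℝ}

theorem w_Id (A : Matrix (Fin 2) (Fin 2) ℝ) : w A Id = 0 := by simp [w, Id]

theorem hasDerivAt_w_comp {v : ℝ × ℝ} {t : ℝ} (h : HasDerivAt q v t) :
    HasDerivAt (fun t => w A (q t)) (dw A v) t := by
  have h1 := (hasFDerivAt_fst (𝕜 := ℝ) (p := q t)).comp_hasDerivAt t h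
  have h2 := (hasFDerivAt_snd (𝕜 := ℝ) (p := q t)).comp_hasDerivAt t h
  exact (h1.add ((h2.sub_const 1).const_mul (nu A))).div_const (lam A)

theorem hasDerivAt_snd_comp {v : ℝ × ℝ} {t : ℝ} (h : HasDerivAt q v t) :
    HasDerivAt (fun t => (q t).2) v.2 t :=
  (hasFDerivAt_snd (𝕜 := ℝ) (p := q t)).comp_hasDerivAt t h

theorem contDiff_w (A : Matrix (Fin 2) (Fin 2) ℝ) : ContDiff ℝ 1 (w A) :=
  (contDiff_fst.add (contDiff_const.mul (contDiff_snd.sub contDiff_const))).div_const _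

theorem IsCausalCurve.ae_velocity (hA : 0 < A.det) (hK : 0 < K A)
    (hq : IsCausalCurve A q₀ q₁ T q) :
    ∀ᵐ t ∂volume.restrict (Icc 0 T), 0 < (q t).2 ∧ HasDerivAt q (deriv q t) t ∧
      0 < s₁ A * (deriv q t).2 ∧ |dw A (deriv q t)| ≤ s₁ A * (deriv q t).2 := by
  filter_upwards [hq.nonspacelike, hq.future, ae_restrict_mem measurableSet_Icc] with t h1 h2 ht
  have hy : 0 < (q t).2 := hq.mem t ht
  have h := (causal_iff hA hK hy _).1 ⟨h1, h2⟩
  refine ⟨hy, ?_, h⟩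
  -- At a point of non-differentiability `deriv` takes the value `0`, which is not future directed.
  by_contra hd
  have h0 : deriv q t = 0 := deriv_zero_of_not_differentiableAt fun h => hd h.hasDerivAt
  rw [h0] at h
  simp at h

/-- Along a curve in `G`, a `C¹` function is absolutely continuous. -/
theorem IsCausalCurve.absolutelyContinuous (hq : IsCausalCurve A q₀ q₁ T q) {F : ℝ × ℝ → ℝ}
    (hF : ContDiffOn ℝ 1 F G) : AbsolutelyContinuousOnInterval (fun t => F (q t)) 0 T := by
  obtain ⟨C, hC⟩ := hq.lipschitz
  have hi : IsCompact (q '' Icc 0 T) := isCompact_Icc.image_of_continuousOn hC.continuousOn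
  have hne : (q '' Icc 0 T).Nonempty := ⟨q 0, mem_image_of_mem q ⟨le_rfl, hq.nonneg⟩⟩
  obtain ⟨z, ⟨t₀, ht₀, rfl⟩, hz⟩ := hi.exists_isMinOn hne continuous_snd.continuousOn
  have hm : 0 < (q t₀).2 := hq.mem t₀ ht₀
  obtain ⟨R, hR⟩ := hi.isBounded.subset_closedBall 0
  -- A `C¹` function is Lipschitz on a compact convex set. Cutting a large ball at the minimal
  -- height of the curve gives such a set inside `G` that contains the curve.
  let S : Set (ℝ × ℝ) := Metric.closedBall 0 R ∩ Prod.snd ⁻¹' Ici (q t₀).2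
  have hc : IsCompact S := (isCompact_closedBall 0 R).inter_right
    (isClosed_Ici.preimage continuous_snd)
  have hconv : Convex ℝ S := (convex_closedBall 0 R).inter
    ((convex_Ici (q t₀).2).linear_preimage (LinearMap.snd ℝ ℝ ℝ))
  have hsub : S ⊆ G := fun x hx => hm.trans_le hx.2
  have hqS : q '' Icc 0 T ⊆ S := fun x hx => ⟨hR hx, hz hx⟩
  obtain ⟨L, hL⟩ := (hF.mono hsub).exists_lipschitzOnWith one_ne_zero hconv hc
  have : LipschitzOnWith (L * C) (fun t => F (q t)) (uIcc 0 T) := by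
    rw [uIcc_of_le hq.nonneg]
    exact hL.comp hC fun t ht => hqS (mem_image_of_mem q ht)
  exact this.absolutelyContinuousOnInterval

theorem IsCausalCurve.integral_deriv (hq : IsCausalCurve A q₀ q₁ T q) {F : ℝ × ℝ → ℝ}
    (hF : ContDiffOn ℝ 1 F G) : ∫ t in (0 : ℝ)..T, deriv (fun t => F (q t)) t = F q₁ - F q₀ := by
  rw [(hq.absolutelyContinuous hF).integral_deriv_eq_sub, hq.start, hq.finish]

theorem IsCausalCurve.intervalIntegrable (hq : IsCausalCurve A q₀ q₁ T q) {F : ℝ × ℝ → ℝ}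
    (hF : ContDiffOn ℝ 1 F G) :
    IntervalIntegrable (deriv fun t => F (q t)) volume 0 T :=
  (hq.absolutelyContinuous hF).intervalIntegrable_deriv

theorem IsCausalCurve.integral_le (hq : IsCausalCurve A q₀ q₁ T q) {F : ℝ × ℝ → ℝ}
    (hF : ContDiffOn ℝ 1 F G) {f : ℝ → ℝ} (h0 : ∀ t, 0 ≤ f t)
    (hf : ∀ᵐ t ∂volume.restrict (Icc 0 T), f t ≤ deriv (fun t => F (q t)) t) :
    ∫ t in (0 : ℝ)..T, f t ≤ F q₁ - F q₀ := by
  rw [← hq.integral_deriv hF, intervalIntegral.integral_of_le hq.nonneg,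
    intervalIntegral.integral_of_le hq.nonneg]
  -- Only the upper function has to be integrable, so no regularity of `f` is needed.
  refine integral_mono_of_nonneg (Filter.Eventually.of_forall h0) (hq.intervalIntegrable hF).1 ?_
  exact ae_restrict_of_ae_restrict_of_subset Ioc_subset_Icc_self hf

theorem contDiffOn_potential (A : Matrix (Fin 2) (Fin 2) ℝ) (c s : ℝ) {φ : ℝ → ℝ}
    (hφ : ContDiffOn ℝ 1 φ (Ioi 0)) : ContDiffOn ℝ 1 (fun q => c * w A q + s * φ q.2) G :=
  (contDiff_const.mul (contDiff_w A)).contDiffOn.add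
    (contDiffOn_const.mul (hφ.comp contDiff_snd.contDiffOn fun _ h => h))

theorem hasDerivAt_potential (c s : ℝ) {φ : ℝ → ℝ} {φ' : ℝ} {v : ℝ × ℝ} {t : ℝ}
    (h : HasDerivAt q v t) (hφ : HasDerivAt φ φ' (q t).2) :
    HasDerivAt (fun t => c * w A (q t) + s * φ (q t).2) (c * dw A v + s * (φ' * v.2)) t := by
  have h2 : HasDerivAt (fun t => φ (q t).2) (φ' * v.2) t :=
    HasDerivAt.comp t hφ (hasDerivAt_snd_comp h)
  exact ((hasDerivAt_w_comp h).const_mul c).add (h2.const_mul s)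

/-- Both null coordinates `s₁ y ± w` are nondecreasing along a causal curve. -/
theorem IsCausalCurve.abs_w_le (hA : 0 < A.det) (hK : 0 < K A)
    (hq : IsCausalCurve A Id q₁ T q) : |w A q₁| ≤ s₁ A * (q₁.2 - 1) := by
  have key : ∀ c : ℝ, |c| = 1 → 0 ≤ c * w A q₁ + s₁ A * (q₁.2 - 1) := by
    intro c hc
    have hF := contDiffOn_potential A c (s₁ A) (φ := fun y => y) contDiffOn_id
    have h := hq.integral_le hF (f := fun _ => 0) (fun _ => le_rfl) (by
      filter_upwards [hq.ae_velocity hA hK] with t ⟨_, hd, _, h2⟩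
      rw [(hasDerivAt_potential c (s₁ A) (φ := fun y => y) hd (hasDerivAt_id' _)).deriv, one_mul]
      have := neg_abs_le (c * dw A (deriv q t))
      rw [abs_mul, hc, one_mul] at this
      linarith)
    simp only [intervalIntegral.integral_zero, w_Id] at h
    simp only [Id] at h
    linarith
  rw [abs_le]
  have h1 := key 1 (by norm_num)
  have h2 := key (-1) (by norm_num)
  constructor <;> linarith

/-- One null coordinate has zero total increment. Its derivative is nonnegative, hence zero almost
everywhere, and the velocity is null. -/
theorem IsCausalCurve.length_eq_zero (hA : 0 < A.det) (hK : 0 < K A)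
    (hq : IsCausalCurve A Id q₁ T q) (h1 : |w A q₁| = s₁ A * (q₁.2 - 1)) :
    length A T q = 0 := by
  obtain ⟨c, hc, hcw⟩ : ∃ c : ℝ, |c| = 1 ∧ c * w A q₁ + s₁ A * (q₁.2 - 1) = 0 := by
    rcases abs_choice (w A q₁) with h | h
    · exact ⟨-1, by norm_num, by rw [← h1, h]; ring⟩
    · exact ⟨1, by norm_num, by rw [← h1, h]; ring⟩
  have hF := contDiffOn_potential A c (s₁ A) (φ := fun y => y) contDiffOn_id
  have hint := hq.integral_deriv hF
  have hv := hq.ae_velocity hA hK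
  have hv' := ae_restrict_of_ae_restrict_of_subset Ioc_subset_Icc_self hv
  have hnn : 0 ≤ᵐ[volume.restrict (Ioc 0 T)]
      deriv (fun t => c * w A (q t) + s₁ A * (q t).2) := by
    filter_upwards [hv'] with t ⟨_, hd, _, h2⟩
    rw [(hasDerivAt_potential c (s₁ A) (φ := fun y => y) hd (hasDerivAt_id' _)).deriv, one_mul]
    have := neg_abs_le (c * dw A (deriv q t))
    rw [abs_mul, hc, one_mul] at this
    simp only [Pi.zero_apply]
    linarith
  have hz : ∫ t in (0 : ℝ)..T, deriv (fun t => c * w A (q t) + s₁ A * (q t).2) t = 0 := by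
    rw [hint, w_Id]
    simp only [Id]
    linarith
  rw [intervalIntegral.integral_of_le hq.nonneg,
    integral_eq_zero_iff_of_nonneg_ae hnn (hq.intervalIntegrable hF).1] at hz
  rw [length, intervalIntegral.integral_of_le hq.nonneg]
  refine integral_eq_zero_of_ae ?_
  filter_upwards [hv', hz] with t ⟨hy, hd, _, h2⟩ h3
  rw [(hasDerivAt_potential c (s₁ A) (φ := fun y => y) hd (hasDerivAt_id' _)).deriv, one_mul] at h3
  simp only [Pi.zero_apply] at h3 ⊢
  have e1 : (c * dw A (deriv q t)) ^ 2 = (s₁ A * (deriv q t).2) ^ 2 := by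
    rw [eq_neg_of_add_eq_zero_left h3, neg_sq]
  have hc2 : c ^ 2 = 1 := by rw [← sq_abs, hc, one_pow]
  have hs2 : s₁ A ^ 2 = 1 := by rw [pow_two, s₁_sq hA hK]
  rw [mul_pow, mul_pow, hc2, hs2, one_mul, one_mul] at e1
  rw [sqrt_abs_g hA hK hy h2, e1, sub_self, Real.sqrt_zero, zero_div]

/-- The `y`-part of a separated solution of the eikonal equation `F_y² - F_w² = y⁻²`. -/
noncomputable def eikonal (p y : ℝ) : ℝ :=
  Real.sqrt (1 + (p * y) ^ 2) + Real.log y - Real.log (1 + Real.sqrt (1 + (p * y) ^ 2))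

theorem contDiffOn_eikonal (p : ℝ) : ContDiffOn ℝ 1 (eikonal p) (Ioi 0) := by
  have h : ContDiffOn ℝ 1 (fun y : ℝ => Real.sqrt (1 + (p * y) ^ 2)) (Ioi 0) := by
    refine ContDiffOn.sqrt (by fun_prop) fun y _ => ?_
    positivity
  refine (h.add (contDiffOn_id.log fun y hy => ne_of_gt hy)).sub
    ((contDiffOn_const.add h).log fun y _ => ?_)
  positivity

theorem hasDerivAt_eikonal (p : ℝ) {y : ℝ} (hy : 0 < y) :
    HasDerivAt (eikonal p) (Real.sqrt (1 + (p * y) ^ 2) / y) y := by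
  have h0 : 0 < 1 + (p * y) ^ 2 := by positivity
  have h1 : HasDerivAt (fun y : ℝ => 1 + (p * y) ^ 2) (2 * p ^ 2 * y) y := by
    refine ((((hasDerivAt_id y).const_mul p).fun_pow 2).const_add 1).congr_deriv ?_
    simp; ring
  have h2 := h1.sqrt h0.ne'
  have hr : 0 < Real.sqrt (1 + (p * y) ^ 2) := Real.sqrt_pos.2 h0
  have h3 := (h2.add (Real.hasDerivAt_log hy.ne')).sub
    ((h2.const_add 1).log (by positivity))
  refine h3.congr_deriv ?_
  have hs := Real.sq_sqrt h0.le
  generalize Real.sqrt (1 + (p * y) ^ 2) = r at *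
  field_simp
  have : p ^ 2 * y ^ 2 = r ^ 2 - 1 := by linarith
  linear_combination r * this

/-- Reversed Cauchy–Schwarz: with `r² = 1 + (u y)²`, one has `(u y W + r Z)² - (Z² - W²) = (u y Z +
r W)²`. Equality holds when `u y Z + r W = 0`. -/
theorem sqrt_le_calibration (u y W Z : ℝ) (hy : 0 < y) (h : |W| ≤ Z) :
    Real.sqrt (Z ^ 2 - W ^ 2) / y ≤ u * W + Real.sqrt (1 + (u * y) ^ 2) / y * Z := by
  have hs := Real.sq_sqrt (show 0 ≤ 1 + (u * y) ^ 2 by positivity)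
  have hr := Real.sqrt_nonneg (1 + (u * y) ^ 2)
  have hle : |u * y| ≤ Real.sqrt (1 + (u * y) ^ 2) := Real.abs_le_sqrt (by linarith)
  generalize Real.sqrt (1 + (u * y) ^ 2) = r at *
  have h1 : 0 ≤ u * y * W + r * Z := by
    have h2 : |u * y * W| ≤ r * Z := by
      rw [abs_mul]; exact mul_le_mul hle h (abs_nonneg _) hr
    linarith [neg_abs_le (u * y * W)]
  rw [div_le_iff₀ hy]
  have e : (u * W + r / y * Z) * y = u * y * W + r * Z := by field_simp
  rw [e, Real.sqrt_le_left h1]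
  nlinarith [sq_nonneg (u * y * Z + r * W)]

/-- The calibration bound for the length. -/
theorem IsCausalCurve.length_le (hA : 0 < A.det) (hK : 0 < K A)
    (hq : IsCausalCurve A Id q₁ T q) (p : ℝ) :
    length A T q ≤ (p * w A q₁ + s₁ A * (eikonal p q₁.2 - eikonal p 1)) / Δ A := by
  have hD := Δ_pos hA hK
  have hF := contDiffOn_potential A p (s₁ A) (contDiffOn_eikonal p)
  have h := hq.integral_le hF (f := fun t => Δ A * Real.sqrt |g A (q t) (deriv q t) (deriv q t)|)
    (fun t => by positivity) (by
      filter_upwards [hq.ae_velocity hA hK] with t ⟨hy, hd, _, h2⟩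
      rw [(hasDerivAt_potential p (s₁ A) hd (hasDerivAt_eikonal p hy)).deriv,
        sqrt_abs_g hA hK hy h2]
      have hs : (s₁ A * (deriv q t).2) ^ 2 = (deriv q t).2 ^ 2 := by
        rw [mul_pow, pow_two (s₁ A), s₁_sq hA hK, one_mul]
      have := sqrt_le_calibration p (q t).2 _ _ hy h2
      rw [hs] at this
      refine le_trans (le_of_eq ?_) (this.trans (le_of_eq ?_))
      · field_simp
      · ring)
  rw [intervalIntegral.integral_const_mul, w_Id] at h
  rw [le_div_iff₀ hD, length, mul_comm]
  refine h.trans (le_of_eq ?_)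
  simp only [Id]
  ring

end Curves

end AffLorentz

namespace AffLorentz

/-! ### Construction of causal curves -/

section Lift

variable {A : Matrix (Fin 2) (Fin 2) ℝ}

/-- The point with given coordinates `(w, y)`. -/
noncomputable def ofWY (A : Matrix (Fin 2) (Fin 2) ℝ) (W Y : ℝ) : ℝ × ℝ :=
  (lam A * W - nu A * (Y - 1), Y)

theorem w_ofWY (hA : 0 < A.det) (hK : 0 < K A) (W Y : ℝ) : w A (ofWY A W Y) = W := by
  have := (lam_pos hA hK).ne'
  simp only [w, ofWY]
  field_simp
  ring

theorem ofWY_w (hA : 0 < A.det) (hK : 0 < K A) (q : ℝ × ℝ) : ofWY A (w A q) q.2 = q := by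
  have := (lam_pos hA hK).ne'
  ext
  · simp only [w, ofWY]
    field_simp
    ring
  · rfl

/-- A curve in the coordinates `(w, y)` that starts at the identity and has continuous
future directed nonspacelike velocity. -/
structure IsCausalPath (A : Matrix (Fin 2) (Fin 2) ℝ) (T : ℝ) (W Y W' Y' : ℝ → ℝ) : Prop where
  nonneg : 0 ≤ T
  hasDerivAt_W : ∀ t ∈ Icc 0 T, HasDerivAt W (W' t) t
  hasDerivAt_Y : ∀ t ∈ Icc 0 T, HasDerivAt Y (Y' t) t
  continuousOn_W' : ContinuousOn W' (Icc 0 T)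
  continuousOn_Y' : ContinuousOn Y' (Icc 0 T)
  pos : ∀ t ∈ Icc 0 T, 0 < Y t
  future : ∀ t ∈ Icc 0 T, 0 < s₁ A * Y' t
  causal : ∀ t ∈ Icc 0 T, |W' t| ≤ s₁ A * Y' t
  W_zero : W 0 = 0
  Y_zero : Y 0 = 1

variable {T : ℝ} {W Y W' Y' : ℝ → ℝ}

theorem IsCausalPath.hasDerivAt (h : IsCausalPath A T W Y W' Y') {t : ℝ} (ht : t ∈ Icc 0 T) :
    HasDerivAt (fun t => ofWY A (W t) (Y t)) (lam A * W' t - nu A * Y' t, Y' t) t :=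
  (((h.hasDerivAt_W t ht).const_mul (lam A)).sub
    (((h.hasDerivAt_Y t ht).sub_const 1).const_mul (nu A))).prodMk (h.hasDerivAt_Y t ht)

theorem dw_velocity (hA : 0 < A.det) (hK : 0 < K A) (a b : ℝ) :
    dw A (lam A * a - nu A * b, b) = a := by
  have := (lam_pos hA hK).ne'
  simp only [dw]
  field_simp
  ring

theorem IsCausalPath.isCausalCurve (hA : 0 < A.det) (hK : 0 < K A)
    (h : IsCausalPath A T W Y W' Y') :
    IsCausalCurve A Id (ofWY A (W T) (Y T)) T (fun t => ofWY A (W t) (Y t)) := by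
  have hc : ∀ t ∈ Icc 0 T, g A (ofWY A (W t) (Y t)) (deriv (fun t => ofWY A (W t) (Y t)) t)
        (deriv (fun t => ofWY A (W t) (Y t)) t) ≤ 0 ∧
      g A (ofWY A (W t) (Y t)) (deriv (fun t => ofWY A (W t) (Y t)) t)
        (Y₁ A (ofWY A (W t) (Y t))) < 0 := by
    intro t ht
    rw [causal_iff hA hK (h.pos t ht), (h.hasDerivAt ht).deriv, dw_velocity hA hK]
    exact ⟨h.future t ht, h.causal t ht⟩
  refine ⟨h.nonneg, h.pos, ?_, ?_, rfl, ?_, ?_⟩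
  · have hcont : ContinuousOn (fun t => (lam A * W' t - nu A * Y' t, Y' t)) (Icc 0 T) :=
      ((continuousOn_const.mul h.continuousOn_W').sub
        (continuousOn_const.mul h.continuousOn_Y')).prodMk h.continuousOn_Y'
    obtain ⟨C, hC⟩ := isCompact_Icc.exists_bound_of_continuousOn hcont
    refine ⟨C.toNNReal, (convex_Icc 0 T).lipschitzOnWith_of_nnnorm_hasDerivWithin_le
      (fun t ht => (h.hasDerivAt ht).hasDerivWithinAt) fun t ht => ?_⟩
    rw [← NNReal.coe_le_coe, coe_nnnorm]
    exact (hC t ht).trans (Real.le_coe_toNNReal C)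
  · simp [ofWY, h.W_zero, h.Y_zero, Id]
  · exact ae_restrict_of_forall_mem measurableSet_Icc fun t ht => (hc t ht).1
  · exact ae_restrict_of_forall_mem measurableSet_Icc fun t ht => (hc t ht).2

/-- The hypothesis `hu` normalizes the Lorentzian speed to the constant `1 / Δ`. -/
theorem IsCausalPath.length_eq (hA : 0 < A.det) (hK : 0 < K A)
    (h : IsCausalPath A T W Y W' Y') (hu : ∀ t ∈ Icc 0 T, Y' t ^ 2 - W' t ^ 2 = Y t ^ 2) :
    length A T (fun t => ofWY A (W t) (Y t)) = T / Δ A := by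
  have e : ∀ t ∈ uIcc 0 T, Real.sqrt |g A (ofWY A (W t) (Y t))
      (deriv (fun t => ofWY A (W t) (Y t)) t) (deriv (fun t => ofWY A (W t) (Y t)) t)| =
      1 / Δ A := by
    intro t ht
    rw [uIcc_of_le h.nonneg] at ht
    have hy := h.pos t ht
    have hD := Δ_pos hA hK
    rw [(h.hasDerivAt ht).deriv, sqrt_abs_g hA hK (by exact hy)
      (by rw [dw_velocity hA hK]; exact h.causal t ht), dw_velocity hA hK]
    simp only [ofWY]
    rw [hu t ht, Real.sqrt_sq hy.le]
    field_simp
  rw [length, intervalIntegral.integral_congr e, intervalIntegral.integral_const]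
  simp [div_eq_mul_inv]

theorem IsCausalPath.le_dist (hA : 0 < A.det) (hK : 0 < K A)
    (h : IsCausalPath A T W Y W' Y') (hu : ∀ t ∈ Icc 0 T, Y' t ^ 2 - W' t ^ 2 = Y t ^ 2) :
    ENNReal.ofReal (T / Δ A) ≤ dist A Id (ofWY A (W T) (Y T)) := by
  rw [← h.length_eq hA hK hu]
  exact le_iSup_of_le T (le_iSup_of_le _ (le_iSup_of_le (h.isCausalCurve hA hK) le_rfl))

theorem dist_le {q₀ q₁ : ℝ × ℝ} {B : ℝ≥0∞}
    (h : ∀ T q, IsCausalCurve A q₀ q₁ T q → ENNReal.ofReal (length A T q) ≤ B) :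
    dist A q₀ q₁ ≤ B :=
  iSup_le fun T => iSup_le fun q => iSup_le fun hq => h T q hq

/-! ### The causal future of the identity -/

theorem causalFuture_Id (hA : 0 < A.det) (hK : 0 < K A) :
    causalFuture A Id = {q | 0 < q.2 ∧ |w A q| ≤ s₁ A * (q.2 - 1)} := by
  ext q₁
  constructor
  · rintro ⟨T, q, hq⟩
    refine ⟨?_, hq.abs_w_le hA hK⟩
    rw [← hq.finish]
    exact hq.mem T ⟨hq.nonneg, le_rfl⟩
  · rintro ⟨hy, hw⟩
    have hs := s₁_sq hA hK
    set T := s₁ A * (q₁.2 - 1) with hT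
    have hT0 : 0 ≤ T := (abs_nonneg _).trans hw
    have hYT : 1 + s₁ A * T = q₁.2 := by rw [hT, ← mul_assoc, hs]; ring
    -- For `T = 0` the bound forces `w = 0`, and division by zero does no harm; otherwise the curve
    -- is a straight segment in `(w, y)`.
    have hWT : w A q₁ / T * T = w A q₁ := by
      rcases hT0.eq_or_lt with h | h
      · rw [← h, abs_nonpos_iff] at hw
        rw [hw]; simp
      · field_simp
    have hp : IsCausalPath A T (fun t => w A q₁ / T * t) (fun t => 1 + s₁ A * t)
        (fun _ => w A q₁ / T) (fun _ => s₁ A) := by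
      refine ⟨hT0, fun t _ => ?_, fun t _ => ?_, continuousOn_const, continuousOn_const,
        fun t ht => ?_, fun t _ => ?_, fun t _ => ?_, by simp, by simp⟩
      · simpa using (hasDerivAt_id t).const_mul (w A q₁ / T)
      · simpa using ((hasDerivAt_id t).const_mul (s₁ A)).const_add 1
      · rcases s₁_cases hA hK with h | h <;> rw [h] at hYT ⊢ <;> linarith [ht.1, ht.2]
      · rw [hs]; exact one_pos
      · rw [hs, abs_div, abs_of_nonneg hT0]
        exact div_le_one_of_le₀ hw hT0
    have hc := hp.isCausalCurve hA hK
    simp only [hYT, hWT, ofWY_w hA hK] at hc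
    exact ⟨T, _, hc⟩

theorem continuous_w (A : Matrix (Fin 2) (Fin 2) ℝ) : Continuous (w A) :=
  (contDiff_w A).continuous

theorem interior_causalFuture_Id (hA : 0 < A.det) (hK : 0 < K A) :
    interior (causalFuture A Id) = {q | 0 < q.2 ∧ |w A q| < s₁ A * (q.2 - 1)} := by
  have hs := s₁_sq hA hK
  have hw := continuous_w A
  apply Subset.antisymm
  · intro q hq
    have hmem := interior_subset hq
    rw [causalFuture_Id hA hK] at hmem
    refine ⟨hmem.1, ?_⟩
    -- An interior point can be moved a little towards the past in `y` with `w` fixed; this makes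
    -- the inequality strict.
    have hcont : Continuous fun e : ℝ => ofWY A (w A q) (q.2 - s₁ A * e) := by
      unfold ofWY; fun_prop
    have h0 : ∀ᶠ e : ℝ in nhds 0, ofWY A (w A q) (q.2 - s₁ A * e) ∈ causalFuture A Id := by
      have := hcont.tendsto 0
      rw [mul_zero, sub_zero, ofWY_w hA hK] at this
      exact this.eventually (mem_interior_iff_mem_nhds.1 hq)
    obtain ⟨e, he, he0⟩ := ((h0.filter_mono nhdsWithin_le_nhds).and
      (self_mem_nhdsWithin (s := Ioi (0 : ℝ)))).exists
    rw [causalFuture_Id hA hK] at he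
    have h1 := he.2
    rw [w_ofWY hA hK] at h1
    have h2 : s₁ A * ((ofWY A (w A q) (q.2 - s₁ A * e)).2 - 1) = s₁ A * (q.2 - 1) - e := by
      simp only [ofWY]
      linear_combination (-e) * hs
    rw [h2] at h1
    have : 0 < e := he0
    linarith
  · apply interior_maximal
    · rw [causalFuture_Id hA hK]
      exact fun q hq => ⟨hq.1, hq.2.le⟩
    · exact (isOpen_lt continuous_const continuous_snd).inter
        (isOpen_lt hw.abs (by fun_prop))

/-- Membership in `G` discards frontier points on the line `y = 0`, which occur when `s₁ = -1`. -/
theorem frontier_causalFuture_Id (hA : 0 < A.det) (hK : 0 < K A) {q : ℝ × ℝ} (hq : q ∈ G)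
    (h : q ∈ frontier (causalFuture A Id)) : |w A q| = s₁ A * (q.2 - 1) := by
  have hw := continuous_w A
  have h1 : closure (causalFuture A Id) ⊆ {q | |w A q| ≤ s₁ A * (q.2 - 1)} := by
    apply closure_minimal
    · rw [causalFuture_Id hA hK]; exact fun q hq => hq.2
    · exact isClosed_le hw.abs (by fun_prop)
  have h2 := h.2
  rw [interior_causalFuture_Id hA hK] at h2
  refine le_antisymm (h1 h.1) (not_lt.1 fun h3 => h2 ⟨hq, h3⟩)

theorem dist_eq_zero_of_notMem {q₁ : ℝ × ℝ} (h : q₁ ∉ causalFuture A Id) : dist A Id q₁ = 0 :=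
  le_antisymm (dist_le fun T q hq => (h ⟨T, q, hq⟩).elim) bot_le

theorem dist_eq_zero_of_mem_frontier (hA : 0 < A.det) (hK : 0 < K A) {q₁ : ℝ × ℝ} (hq : q₁ ∈ G)
    (h : q₁ ∈ frontier (causalFuture A Id)) : dist A Id q₁ = 0 := by
  refine le_antisymm (dist_le fun T q hc => ?_) bot_le
  rw [hc.length_eq_zero hA hK (frontier_causalFuture_Id hA hK hq h), ENNReal.ofReal_zero]

end Lift

/-! ### Maximizing curves -/

section Maximizers

variable {A : Matrix (Fin 2) (Fin 2) ℝ}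

theorem dist_of_w_eq_zero (hA : 0 < A.det) (hK : 0 < K A) {q : ℝ × ℝ} (hy : 0 < q.2)
    (hs : 0 ≤ s₁ A * Real.log q.2) (hw : w A q = 0) :
    dist A Id q = ENNReal.ofReal (s₁ A * (Real.log q.2 / Δ A)) := by
  have hss := s₁_sq hA hK
  rw [← mul_div_assoc]
  apply le_antisymm
  · refine dist_le fun T c hc => ENNReal.ofReal_le_ofReal ((hc.length_le hA hK 0).trans_eq ?_)
    simp [eikonal]
  · have hp : IsCausalPath A (s₁ A * Real.log q.2) (fun _ => 0) (fun t => Real.exp (s₁ A * t))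
        (fun _ => 0) (fun t => s₁ A * Real.exp (s₁ A * t)) := by
      refine ⟨hs, fun t _ => hasDerivAt_const t 0, fun t _ => ?_, continuousOn_const,
        by fun_prop, fun t _ => Real.exp_pos _, fun t _ => ?_, fun t _ => ?_, rfl, by simp⟩
      · refine (((hasDerivAt_id t).const_mul (s₁ A)).exp).congr_deriv ?_
        simp [mul_comm]
      · rw [← mul_assoc, hss, one_mul]; exact Real.exp_pos _
      · rw [← mul_assoc, hss, one_mul, abs_zero]; exact (Real.exp_pos _).le
    have h := hp.le_dist hA hK fun t _ => by
      rw [mul_pow, pow_two (s₁ A), hss]; ring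
    have e : ofWY A 0 (Real.exp (s₁ A * (s₁ A * Real.log q.2))) = q := by
      rw [← mul_assoc, hss, one_mul, Real.exp_log hy, ← hw, ofWY_w hA hK]
    rwa [e] at h

/-- On the hyperbola the square root equals `coth θ`, and the logarithms collapse through `sinh θ +
cosh θ = exp θ`; the term `-θ` is what becomes the length. -/
theorem eikonal_geodesic {p ρ θ : ℝ} (hρ : 0 < ρ) (hθ : 0 < θ)
    (hp : p ^ 2 = (Real.sinh ρ ^ 2)⁻¹) :
    eikonal p (Real.sinh ρ / Real.sinh θ) =
      Real.cosh θ / Real.sinh θ + Real.log (Real.sinh ρ) - θ := by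
  have h1 := Real.sinh_pos_iff.2 hρ
  have h2 := Real.sinh_pos_iff.2 hθ
  have hc := Real.cosh_pos θ
  have hr : Real.sqrt (1 + (p * (Real.sinh ρ / Real.sinh θ)) ^ 2) =
      Real.cosh θ / Real.sinh θ := by
    rw [← Real.sqrt_sq (show 0 ≤ Real.cosh θ / Real.sinh θ by positivity)]
    congr 1
    rw [mul_pow, hp, div_pow, div_pow, Real.cosh_sq]
    field_simp
  have he : 1 + Real.cosh θ / Real.sinh θ = Real.exp θ / Real.sinh θ := by
    rw [← Real.sinh_add_cosh]; field_simp
  rw [eikonal, hr, he, Real.log_div h1.ne' h2.ne', Real.log_div (Real.exp_ne_zero _) h2.ne',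
    Real.log_exp]
  ring

theorem isCausalPath_geodesic (hA : 0 < A.det) (hK : 0 < K A) {ρ τ ε : ℝ} (hρ : 0 < ρ)
    (hτ : 0 < τ) (hs : 0 ≤ s₁ A * (ρ - τ)) (hε : |ε| = 1) :
    IsCausalPath A (s₁ A * (ρ - τ))
      (fun t => ε * (Real.sinh ρ * (Real.cosh (ρ - s₁ A * t) / Real.sinh (ρ - s₁ A * t))
        - Real.cosh ρ))
      (fun t => Real.sinh ρ / Real.sinh (ρ - s₁ A * t))
      (fun t => ε * (s₁ A * Real.sinh ρ / Real.sinh (ρ - s₁ A * t) ^ 2))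
      (fun t => s₁ A * (Real.sinh ρ * Real.cosh (ρ - s₁ A * t)) /
        Real.sinh (ρ - s₁ A * t) ^ 2) := by
  have hss := s₁_sq hA hK
  have hsρ := Real.sinh_pos_iff.2 hρ
  have hθ : ∀ t ∈ Icc 0 (s₁ A * (ρ - τ)), 0 < ρ - s₁ A * t := by
    intro t ht
    rcases s₁_cases hA hK with h | h <;> rw [h] at ht ⊢ <;> linarith [ht.1, ht.2]
  have hsθ : ∀ t ∈ Icc 0 (s₁ A * (ρ - τ)), 0 < Real.sinh (ρ - s₁ A * t) := fun t ht =>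
    Real.sinh_pos_iff.2 (hθ t ht)
  have hdθ : ∀ t, HasDerivAt (fun t => ρ - s₁ A * t) (-s₁ A) t := fun t => by
    simpa using ((hasDerivAt_id t).const_mul (s₁ A)).const_sub ρ
  refine ⟨hs, fun t ht => ?_, fun t ht => ?_, ?_, ?_, fun t ht => ?_, fun t ht => ?_,
    fun t ht => ?_, ?_, ?_⟩
  · have h1 := hsθ t ht
    refine (((((hdθ t).cosh.div (hdθ t).sinh h1.ne').const_mul (Real.sinh ρ)).sub_const
      (Real.cosh ρ)).const_mul ε).congr_deriv ?_
    have := Real.cosh_sq (ρ - s₁ A * t)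
    field_simp
    linear_combination ε * s₁ A * this
  · have h1 := hsθ t ht
    refine ((hasDerivAt_const t (Real.sinh ρ)).div (hdθ t).sinh h1.ne').congr_deriv ?_
    field_simp
    ring
  · refine continuousOn_const.mul (ContinuousOn.div continuousOn_const (by fun_prop)
      fun t ht => pow_ne_zero 2 (hsθ t ht).ne')
  · exact ContinuousOn.div (by fun_prop) (by fun_prop) fun t ht => pow_ne_zero 2 (hsθ t ht).ne'
  · exact div_pos hsρ (hsθ t ht)
  · have h1 := hsθ t ht
    rw [← mul_div_assoc, ← mul_assoc, hss, one_mul]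
    have := Real.cosh_pos (ρ - s₁ A * t)
    positivity
  · have h1 := hsθ t ht
    have hs1 : |s₁ A| = 1 := by rcases s₁_cases hA hK with h | h <;> rw [h] <;> norm_num
    rw [← mul_div_assoc (s₁ A), ← mul_assoc (s₁ A) (s₁ A), hss, one_mul, abs_mul, hε, one_mul,
      abs_div, abs_mul, hs1, one_mul, abs_of_pos hsρ, abs_of_pos (pow_pos h1 2)]
    gcongr
    exact le_mul_of_one_le_right hsρ.le (Real.one_le_cosh _)
  · rw [mul_zero, sub_zero]
    field_simp
    ring
  · rw [mul_zero, sub_zero]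
    exact div_self hsρ.ne'

theorem dist_geodesic (hA : 0 < A.det) (hK : 0 < K A) {ρ τ ε : ℝ} (hρ : 0 < ρ) (hτ : 0 < τ)
    (hs : 0 ≤ s₁ A * (ρ - τ)) (hε : |ε| = 1) {q : ℝ × ℝ}
    (hy : q.2 = Real.sinh ρ / Real.sinh τ)
    (hw : w A q = ε * (Real.sinh ρ * (Real.cosh τ / Real.sinh τ) - Real.cosh ρ)) :
    dist A Id q = ENNReal.ofReal (s₁ A * ((ρ - τ) / Δ A)) := by
  have hss := s₁_sq hA hK
  have hε2 : ε * ε = 1 := by rw [← abs_mul_abs_self, hε, one_mul]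
  have hsρ := Real.sinh_pos_iff.2 hρ
  have hsτ := Real.sinh_pos_iff.2 hτ
  rw [← mul_div_assoc]
  apply le_antisymm
  -- This value of `p` makes `u y Z + r W` vanish along the hyperbola, the equality case of
  -- `sqrt_le_calibration`.
  · refine dist_le fun T c hc => ENNReal.ofReal_le_ofReal
      ((hc.length_le hA hK (-(s₁ A * ε / Real.sinh ρ))).trans_eq ?_)
    have hp : (-(s₁ A * ε / Real.sinh ρ)) ^ 2 = (Real.sinh ρ ^ 2)⁻¹ := by
      rw [neg_sq, div_pow, mul_pow, pow_two (s₁ A), hss, pow_two ε, hε2, one_mul, one_div]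
    have h1 : eikonal (-(s₁ A * ε / Real.sinh ρ)) 1 =
        Real.cosh ρ / Real.sinh ρ + Real.log (Real.sinh ρ) - ρ := by
      rw [← eikonal_geodesic hρ hρ hp, div_self hsρ.ne']
    congr 1
    rw [hy, hw, eikonal_geodesic hρ hτ hp, h1]
    field_simp
    linear_combination (-s₁ A * Real.sinh ρ * Real.cosh τ + s₁ A * Real.cosh ρ * Real.sinh τ) * hε2
  · have h := (isCausalPath_geodesic hA hK hρ hτ hs hε).le_dist hA hK fun t ht => by
      have hθ : 0 < ρ - s₁ A * t := by
        rcases s₁_cases hA hK with h | h <;> rw [h] at ht ⊢ <;> linarith [ht.1, ht.2]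
      have h1 := Real.sinh_pos_iff.2 hθ
      rw [div_pow, div_pow, mul_pow ε, div_pow, mul_pow, mul_pow, mul_pow (s₁ A), Real.cosh_sq,
        pow_two (s₁ A), hss, pow_two ε, hε2]
      field_simp
      ring
    have e : ρ - s₁ A * (s₁ A * (ρ - τ)) = τ := by rw [← mul_assoc, hss]; ring
    simp only [e] at h
    rwa [← hw, ← hy, ofWY_w hA hK] at h

end Maximizers

end AffLorentz

namespace AffLorentz

/-! ### The explicit formulas for the distance -/

section Formulas

variable {A : Matrix (Fin 2) (Fin 2) ℝ}

theorem s₂_div_w (hA : 0 < A.det) (hK : 0 < K A) {q : ℝ × ℝ} (hw : w A q ≠ 0) :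
    s₂ A q / w A q = -(s₁ A / |w A q|) := by
  have hl := lam_pos hA hK
  have h : Real.sign (lam A * w A q) = Real.sign (w A q) := by
    rcases lt_or_gt_of_ne hw with h | h
    · rw [Real.sign_of_neg h, Real.sign_of_neg (mul_neg_of_pos_of_neg hl h)]
    · rw [Real.sign_of_pos h, Real.sign_of_pos (mul_pos hl h)]
  rw [s₂, h]
  rcases lt_or_gt_of_ne hw with h | h
  · rw [Real.sign_of_neg h, abs_of_neg h]; field_simp
  · rw [Real.sign_of_pos h, abs_of_pos h]; field_simp

theorem coshTau_eq (hA : 0 < A.det) (hK : 0 < K A) {q : ℝ × ℝ} (hw : w A q ≠ 0) :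
    coshTau A q = s₁ A * (q.2 ^ 2 + |w A q| ^ 2 - 1) / (2 * q.2 * |w A q|) := by
  have e : coshTau A q = s₂ A q / w A q * ((1 - q.2 ^ 2 - w A q ^ 2) / (2 * q.2)) := by
    rw [coshTau, div_mul_div_comm, ← mul_div_assoc, mul_comm (w A q)]
  rw [e, s₂_div_w hA hK hw, ← sq_abs (w A q), ← neg_div, div_mul_div_comm]
  ring

theorem coshRho_eq (hA : 0 < A.det) (hK : 0 < K A) {q : ℝ × ℝ} (hw : w A q ≠ 0) :
    coshRho A q = s₁ A * (q.2 ^ 2 - |w A q| ^ 2 - 1) / (2 * |w A q|) := by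
  have e : coshRho A q = s₂ A q / w A q * ((1 - q.2 ^ 2 + w A q ^ 2) / 2) := by
    rw [coshRho, div_mul_div_comm, ← mul_div_assoc, mul_comm (w A q)]
  rw [e, s₂_div_w hA hK hw, ← sq_abs (w A q), ← neg_div, div_mul_div_comm]
  ring

/-- After clearing denominators this reads `(y - |w|)² > 1` if `s₁ = 1` and `(y + |w|)² < 1` if `s₁
= -1`. -/
theorem one_lt_coshTau (hA : 0 < A.det) (hK : 0 < K A) {q : ℝ × ℝ} (hy : 0 < q.2)
    (hi : |w A q| < s₁ A * (q.2 - 1)) (hw : w A q ≠ 0) : 1 < coshTau A q := by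
  have hm := abs_pos.2 hw
  rw [coshTau_eq hA hK hw, lt_div_iff₀ (by positivity)]
  rcases s₁_cases hA hK with h | h <;> rw [h] at hi ⊢ <;> nlinarith

theorem one_lt_coshRho (hA : 0 < A.det) (hK : 0 < K A) {q : ℝ × ℝ} (hy : 0 < q.2)
    (hi : |w A q| < s₁ A * (q.2 - 1)) (hw : w A q ≠ 0) : 1 < coshRho A q := by
  have hm := abs_pos.2 hw
  rw [coshRho_eq hA hK hw, lt_div_iff₀ (by positivity)]
  rcases s₁_cases hA hK with h | h <;> rw [h] at hi ⊢ <;> nlinarith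

/-- The identity `coshRho² - 1 = y² (coshTau² - 1)` puts the endpoint at height `sinh ρ / sinh τ`.
-/
theorem sinh_ρ (hA : 0 < A.det) (hK : 0 < K A) {q : ℝ × ℝ} (hy : 0 < q.2)
    (hi : |w A q| < s₁ A * (q.2 - 1)) (hw : w A q ≠ 0) :
    Real.sinh (ρ A q) = q.2 * Real.sinh (τ A q) := by
  have hm := abs_pos.2 hw
  rw [ρ, τ, Real.sinh_arcosh (one_lt_coshRho hA hK hy hi hw).le,
    Real.sinh_arcosh (one_lt_coshTau hA hK hy hi hw).le]
  conv_rhs => rw [← Real.sqrt_sq hy.le, ← Real.sqrt_mul (sq_nonneg _)]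
  rw [coshTau_eq hA hK hw, coshRho_eq hA hK hw]
  have hs2 : s₁ A ^ 2 = 1 := by rw [pow_two, s₁_sq hA hK]
  simp only [div_pow, mul_pow, hs2]
  congr 1
  field_simp
  ring

theorem s₁_mul_ρ_sub_τ_pos (hA : 0 < A.det) (hK : 0 < K A) {q : ℝ × ℝ} (hy : 0 < q.2)
    (hi : |w A q| < s₁ A * (q.2 - 1)) (hw : w A q ≠ 0) : 0 < s₁ A * (ρ A q - τ A q) := by
  have h := sinh_ρ hA hK hy hi hw
  have hτ : 0 < Real.sinh (τ A q) :=
    Real.sinh_pos_iff.2 (Real.arcosh_pos (one_lt_coshTau hA hK hy hi hw))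
  have hm := abs_nonneg (w A q)
  rcases s₁_cases hA hK with hs | hs <;> rw [hs] at hi ⊢
  · have : τ A q < ρ A q := by
      rw [← Real.sinh_lt_sinh, h]; nlinarith
    linarith
  · have : ρ A q < τ A q := by
      rw [← Real.sinh_lt_sinh, h]; nlinarith
    linarith

theorem dist_of_w_ne_zero (hA : 0 < A.det) (hK : 0 < K A) {q : ℝ × ℝ} (hy : 0 < q.2)
    (hi : |w A q| < s₁ A * (q.2 - 1)) (hw : w A q ≠ 0) :
    dist A Id q = ENNReal.ofReal (s₁ A * ((ρ A q - τ A q) / Δ A)) := by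
  have hm := abs_pos.2 hw
  have hτ1 := one_lt_coshTau hA hK hy hi hw
  have hρ1 := one_lt_coshRho hA hK hy hi hw
  have hτ : 0 < τ A q := Real.arcosh_pos hτ1
  have hρ : 0 < ρ A q := Real.arcosh_pos hρ1
  have hsτ := Real.sinh_pos_iff.2 hτ
  have hsh := sinh_ρ hA hK hy hi hw
  have hsg : |Real.sign (w A q)| = 1 := by
    rcases Real.sign_apply_eq_of_ne_zero _ hw with h | h <;> rw [h] <;> norm_num
  have hs1 : |s₁ A| = 1 := by rcases s₁_cases hA hK with h | h <;> rw [h] <;> norm_num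
  refine dist_geodesic hA hK hρ hτ (s₁_mul_ρ_sub_τ_pos hA hK hy hi hw).le
    -- The bracket multiplying `ε` equals `sinh (ρ - τ) / sinh τ`, which has the sign `s₁`; this
    -- forces the choice of `ε`.
    (ε := s₁ A * Real.sign (w A q)) (by rw [abs_mul, hsg, hs1, one_mul]) ?_ ?_
  · rw [hsh]; field_simp
  · have e : q.2 * coshTau A q - coshRho A q = s₁ A * |w A q| := by
      rw [coshTau_eq hA hK hw, coshRho_eq hA hK hw]
      field_simp
      ring
    have e1 : Real.sign (w A q) * |w A q| = w A q := by
      rcases lt_or_gt_of_ne hw with h | h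
      · rw [Real.sign_of_neg h, abs_of_neg h]; ring
      · rw [Real.sign_of_pos h, abs_of_pos h]; ring
    have e2 : Real.sinh (ρ A q) * (Real.cosh (τ A q) / Real.sinh (τ A q)) =
        q.2 * coshTau A q := by
      rw [hsh, τ, Real.cosh_arcosh hτ1.le, ← τ]; field_simp
    rw [e2, ρ, Real.cosh_arcosh hρ1.le, e]
    linear_combination (-Real.sign (w A q) * |w A q|) * s₁_sq hA hK - e1

/-- Strict superadditivity of `sinh` places the endpoints of the hyperbola arcs strictly inside the
cone. -/
theorem sinh_add_sinh_lt {a b : ℝ} (ha : 0 < a) (hb : 0 < b) :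
    Real.sinh a + Real.sinh b < Real.sinh (a + b) := by
  rw [Real.sinh_add]
  have h1 := Real.sinh_pos_iff.2 ha
  have h2 := Real.sinh_pos_iff.2 hb
  have h3 := Real.one_lt_cosh.2 ha.ne'
  have h4 := Real.one_lt_cosh.2 hb.ne'
  nlinarith

theorem exists_dist_eq (hA : 0 < A.det) (hK : 0 < K A) {r : ℝ} (hr : 0 < r) :
    ∃ q : ℝ × ℝ, 0 < q.2 ∧ |w A q| < s₁ A * (q.2 - 1) ∧ w A q ≠ 0 ∧
      dist A Id q = ENNReal.ofReal r := by
  have hD := Δ_pos hA hK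
  have hss := s₁_sq hA hK
  obtain ⟨ρ, τ, hρ, hτ, hs⟩ : ∃ ρ τ : ℝ, 0 < ρ ∧ 0 < τ ∧ s₁ A * (ρ - τ) = Δ A * r := by
    have := mul_pos hD hr
    rcases s₁_cases hA hK with h | h <;> rw [h]
    · exact ⟨1 + Δ A * r, 1, by linarith, one_pos, by ring⟩
    · exact ⟨1, 1 + Δ A * r, one_pos, by linarith, by ring⟩
  have hsρ := Real.sinh_pos_iff.2 hρ
  have hsτ := Real.sinh_pos_iff.2 hτ
  have hpos : 0 < s₁ A * (ρ - τ) := by rw [hs]; positivity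
  have hW : Real.sinh ρ * (Real.cosh τ / Real.sinh τ) - Real.cosh ρ =
      Real.sinh (ρ - τ) / Real.sinh τ := by
    rw [Real.sinh_sub]; field_simp
  have hYpos : 0 < Real.sinh ρ / Real.sinh τ := by positivity
  refine ⟨ofWY A (Real.sinh (ρ - τ) / Real.sinh τ) (Real.sinh ρ / Real.sinh τ), hYpos, ?_, ?_, ?_⟩
  · rw [w_ofWY hA hK, abs_div, abs_of_pos hsτ, div_lt_iff₀ hsτ]
    have e : s₁ A * ((ofWY A (Real.sinh (ρ - τ) / Real.sinh τ)
        (Real.sinh ρ / Real.sinh τ)).2 - 1) * Real.sinh τ =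
        s₁ A * (Real.sinh ρ - Real.sinh τ) := by
      simp only [ofWY]
      field_simp
    rw [e]
    rcases s₁_cases hA hK with h | h <;> rw [h] at hpos ⊢
    · have h1 : 0 < ρ - τ := by linarith
      have := sinh_add_sinh_lt h1 hτ
      rw [sub_add_cancel] at this
      rw [abs_of_pos (Real.sinh_pos_iff.2 h1)]
      linarith
    · have h1 : 0 < τ - ρ := by linarith
      have := sinh_add_sinh_lt h1 hρ
      rw [sub_add_cancel] at this
      rw [← neg_sub τ ρ, Real.sinh_neg, abs_neg, abs_of_pos (Real.sinh_pos_iff.2 h1)]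
      linarith
  · rw [w_ofWY hA hK]
    refine div_ne_zero (fun h0 => ?_) hsτ.ne'
    rw [Real.sinh_eq_zero] at h0
    rw [h0, mul_zero] at hpos
    exact lt_irrefl _ hpos
  · rw [dist_geodesic hA hK hρ hτ hpos.le (abs_one) rfl (by rw [w_ofWY hA hK, hW, one_mul]),
      ← mul_div_assoc, hs, mul_div_cancel_left₀ _ hD.ne']

end Formulas

end AffLorentz

/-! ### Assembly. Since `G` is open in the plane, interior and frontier at points of `G` agree with
those taken in `G`. -/

theorem mainTheorem4 (A : Matrix (Fin 2) (Fin 2) ℝ) (hA : 0 < A.det) (hK : 0 < AffLorentz.K A) :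
    (∀ q₁ ∈ AffLorentz.G, q₁ ∉ AffLorentz.causalFuture A AffLorentz.Id →
      AffLorentz.dist A AffLorentz.Id q₁ = 0) ∧
    (∀ q₁ ∈ AffLorentz.G, q₁ ∈ frontier (AffLorentz.causalFuture A AffLorentz.Id) →
      AffLorentz.dist A AffLorentz.Id q₁ = 0) ∧
    (∀ q₁ ∈ interior (AffLorentz.causalFuture A AffLorentz.Id) ∩ {q | AffLorentz.w A q ≠ 0},
      1 < AffLorentz.coshTau A q₁ ∧ 1 < AffLorentz.coshRho A q₁ ∧
      AffLorentz.dist A AffLorentz.Id q₁ =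
        ENNReal.ofReal
          (AffLorentz.s₁ A * ((AffLorentz.ρ A q₁ - AffLorentz.τ A q₁) / AffLorentz.Δ A))) ∧
    AffLorentz.dist A AffLorentz.Id ''
        (interior (AffLorentz.causalFuture A AffLorentz.Id) ∩ {q | AffLorentz.w A q ≠ 0}) =
      Ioo 0 ⊤ ∧
    (∀ q₁ ∈ interior (AffLorentz.causalFuture A AffLorentz.Id) ∩ {q | AffLorentz.w A q = 0},
      AffLorentz.dist A AffLorentz.Id q₁ =
        ENNReal.ofReal (AffLorentz.s₁ A * (Real.log q₁.2 / AffLorentz.Δ A))) ∧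
    AffLorentz.dist A AffLorentz.Id ''
        (interior (AffLorentz.causalFuture A AffLorentz.Id) ∩ {q | AffLorentz.w A q = 0}) =
      Ioo 0 ⊤ := by
  open AffLorentz in
  have hD := Δ_pos hA hK
  have hlog : ∀ q : ℝ × ℝ, 0 < q.2 → |w A q| < s₁ A * (q.2 - 1) → 0 < s₁ A * Real.log q.2 := by
    intro q hy hi
    have := abs_nonneg (w A q)
    rcases s₁_cases hA hK with h | h <;> rw [h] at hi ⊢
    · rw [one_mul]; exact Real.log_pos (by linarith)
    · linarith [Real.log_neg hy (by linarith)]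
  have h4 : ∀ q ∈ interior (causalFuture A Id) ∩ {q | w A q = 0},
      dist A Id q = ENNReal.ofReal (s₁ A * (Real.log q.2 / Δ A)) := by
    rw [interior_causalFuture_Id hA hK]
    rintro q ⟨⟨hy, hi⟩, hw⟩
    exact dist_of_w_eq_zero hA hK hy (hlog q hy hi).le hw
  refine ⟨fun q _ h => dist_eq_zero_of_notMem h,
    fun q hq h => dist_eq_zero_of_mem_frontier hA hK hq h, ?_, ?_, h4, ?_⟩
  · rw [interior_causalFuture_Id hA hK]
    rintro q ⟨⟨hy, hi⟩, hw⟩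
    exact ⟨one_lt_coshTau hA hK hy hi hw, one_lt_coshRho hA hK hy hi hw,
      dist_of_w_ne_zero hA hK hy hi hw⟩
  · rw [interior_causalFuture_Id hA hK]
    apply Subset.antisymm
    · rintro _ ⟨q, ⟨⟨hy, hi⟩, hw⟩, rfl⟩
      rw [dist_of_w_ne_zero hA hK hy hi hw, ← mul_div_assoc]
      exact ⟨ENNReal.ofReal_pos.2 (div_pos (s₁_mul_ρ_sub_τ_pos hA hK hy hi hw) hD),
        ENNReal.ofReal_lt_top⟩
    · rintro x ⟨h0, htop⟩
      obtain ⟨q, hy, hi, hw, hd⟩ := exists_dist_eq hA hK (ENNReal.toReal_pos h0.ne' htop.ne)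
      exact ⟨q, ⟨⟨hy, hi⟩, hw⟩, by rw [hd, ENNReal.ofReal_toReal htop.ne]⟩
  · apply Subset.antisymm
    · rintro _ ⟨q, hq, rfl⟩
      rw [h4 q hq, ← mul_div_assoc]
      rw [interior_causalFuture_Id hA hK] at hq
      exact ⟨ENNReal.ofReal_pos.2 (div_pos (hlog q hq.1.1 hq.1.2) hD), ENNReal.ofReal_lt_top⟩
    · rintro x ⟨h0, htop⟩
      have hr := mul_pos hD (ENNReal.toReal_pos h0.ne' htop.ne)
      -- The height solves `s₁ log y / Δ = x.toReal`.
      have hq : ofWY A 0 (Real.exp (s₁ A * (Δ A * x.toReal))) ∈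
          interior (causalFuture A Id) ∩ {q | w A q = 0} := by
        rw [interior_causalFuture_Id hA hK]
        refine ⟨⟨Real.exp_pos _, ?_⟩, w_ofWY hA hK _ _⟩
        rw [w_ofWY hA hK, abs_zero]
        simp only [ofWY]
        rcases s₁_cases hA hK with h | h <;> rw [h]
        · linarith [Real.one_lt_exp_iff.2 (show 0 < 1 * (Δ A * x.toReal) by linarith)]
        · linarith [Real.exp_lt_one_iff.2 (show -1 * (Δ A * x.toReal) < 0 by linarith)]
      refine ⟨_, hq, ?_⟩
      rw [h4 _ hq]
      simp only [ofWY]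
      rw [Real.log_exp, ← mul_div_assoc, ← mul_assoc, s₁_sq hA hK, one_mul,
        mul_div_cancel_left₀ _ hD.ne', ENNReal.ofReal_toReal htop.ne]
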